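/- Theorem (General dimension criterion for e-families). Let $(\mathcal Y,\mathcal E)$ be a finite strongly connected digraph. Let $\mathcal F(\mathcal Y,\mathcal E)=\mathbb R^{\mathcal E}$, let $\mathcal F^+(\mathcal Y,\mathcal E)$ be its subset of positive functions, and regard elements of $\mathcal F(\mathcal Y,\mathcal E)$ as $\mathcal Y\times\mathcal Y$ matrices that vanish off $\mathcal E$. Let $\mathcal W(\mathcal Y,\mathcal E)\subset\mathcal F^+(\mathcal Y,\mathcal E)$ be the set of row-stochastic matrices that are positive exactly on $\mathcal E$. For $F\in\mathcal F^+(\mathcal Y,\mathcal E)$ with Perron--Frobenius root $\rho_F$ and positive right eigenvector $v_F$, let $$\mathfrak s(F)(y,y')=\frac{F(y,y')\,v_F(y')}{\rho_F\,v_F(y)},\qquad (y,y')\in\mathcal E,$$ and let $\exp,\log$ act entrywise on $\mathcal E$. Let $\mathcal N(\mathcal Y,\mathcal E)$ be the space of functions $(y,y')\mapsto f(y')-f(y)+c$ on $\mathcal E$, with $f\in\mathbb R^{\mathcal Y}$ and $c\in\mathbb R$. A set $\mathcal V\subset\mathcal W(\mathcal Y,\mathcal E)$ is called an e-family if $$\mathcal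 V=\Big\{\mathfrak s\Big(\exp\Big(K+\sum_{i=1}^d\theta^iG_i\Big)\Big):\theta\in\mathbb R^d\Big\}$$ for some $d\ge 0$ and $K,G_1,\dots,G_d\in\mathcal F(\mathcal Y,\mathcal E)$ such that the classes of $G_1,\dots,G_d$ in $\mathcal F(\mathcal Y,\mathcal E)/\mathcal N(\mathcal Y,\mathcal E)$ are linearly independent. The e-hull of $\mathcal V\subset\mathcal W(\mathcal Y,\mathcal E)$ is $$\operatorname{ehull}(\mathcal V)=\Big\{\mathfrak s(\widetilde P):\widetilde P\in\mathcal F^+(\mathcal Y,\mathcal E),\ \log\widetilde P=\sum_{i=1}^k\alpha_i\log P_i,\ k\in\mathbb N,\ \alpha\in\mathbb R^k,\ \sum_{i=1}^k\alpha_i=1,\ P_1,\dots,P_k\in\mathcal V\Big\}.$$ Let $\mathcal V$ be a nonempty smooth embedded submanifold (without boundary) of $\mathcal W(\mathcal Y,\mathcal E)$ such that (i) $\dim\mathcal V=\dim\operatorname{ehull}(\mathcal V)$, as manifolds; (ii) there exist a finite-dimensional Hausdorff real topological vector space $\mathcal U$, a linear map $\phi:\mathcal F(\mathcal Y,\mathcal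 E)\to\mathcal U$ and $C\in\mathcal U$ such that $\mathcal V=\mathcal W(\mathcal Y,\mathcal E)\cap\{F\in\mathcal F(\mathcal Y,\mathcal E):\phi(F)=C\}$. Then $\mathcal V$ is an e-family. -/

import Mathlib

open scoped ContDiff Matrix

namespace MarkovEFamily

noncomputable section

/-! ## Digraphs, functions on edges, irreducible stochastic matrices -/

/-- The digraph with vertex set `Y` and edge set `E` is strongly connected: every vertex can be
reached from every vertex along directed edges. -/
def StronglyConnected {Y : Type*} (E : Finset (Y × Y)) : Prop :=
  ∀ y y' : Y, Relation.ReflTransGen (fun a b => (a, b) ∈ E) y y'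

/-- `F(Y, E) = ℝ^E`, the real functions on the edge set. -/
abbrev EdgeFun {Y : Type*} (E : Finset (Y × Y)) : Type _ := E → ℝ

/-- A function on the edges as a square matrix, with zero entries off the edge set. -/
def toMatrix {Y : Type*} [DecidableEq Y] {E : Finset (Y × Y)} (F : EdgeFun E) : Matrix Y Y ℝ :=
  Matrix.of fun y y' => if h : (y, y') ∈ E then F ⟨(y, y'), h⟩ else 0

/-- `F⁺(Y, E)`, the positive functions on the edge set. -/
def positiveEdgeFun {Y : Type*} (E : Finset (Y × Y)) : Set (EdgeFun E) :=
  {F | ∀ e, 0 < F e}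

/-- `W(Y, E)`, the row-stochastic matrices with connection graph `(Y, E)`: entries are positive
exactly on `E` and rows sum to one. For a strongly connected graph they are irreducible. -/
def stochasticFamily {Y : Type*} [Fintype Y] [DecidableEq Y] (E : Finset (Y × Y)) :
    Set (EdgeFun E) :=
  {P | P ∈ positiveEdgeFun E ∧ ∀ y, ∑ y', toMatrix P y y' = 1}

/-- Entrywise exponential. -/
def expE {Y : Type*} {E : Finset (Y × Y)} (F : EdgeFun E) : EdgeFun E := fun e => Real.exp (F e)

/-- Entrywise logarithm (used on positive functions only). -/
def logE {Y : Type*} {E : Finset (Y × Y)} (F : EdgeFun E) : EdgeFun E := fun e => Real.log (F e)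

/-! ## The normalization `s` -/

/-- `(ρ, v)` is a right Perron–Frobenius eigenpair of `A`: `v` is a positive right eigenvector for
`ρ`, and no complex eigenvalue of `A` has modulus larger than `ρ`. -/
def IsPerronPair {Y : Type*} [Fintype Y] [DecidableEq Y] (A : Matrix Y Y ℝ) (ρ : ℝ) (v : Y → ℝ) :
    Prop :=
  (∀ y, 0 < v y) ∧ A *ᵥ v = ρ • v ∧
    ∀ μ ∈ spectrum ℂ (A.map (fun x : ℝ => (x : ℂ))), ‖μ‖ ≤ ρ

/-- A right Perron–Frobenius eigenpair of `A`. For an irreducible nonnegative matrix it exists, and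
is unique up to a positive factor in the eigenvector. -/
def perronPair {Y : Type*} [Fintype Y] [DecidableEq Y] (A : Matrix Y Y ℝ) : ℝ × (Y → ℝ) :=
  Classical.epsilon fun p => IsPerronPair A p.1 p.2

/-- The Perron–Frobenius root `ρ_F`. -/
def perronRoot {Y : Type*} [Fintype Y] [DecidableEq Y] {E : Finset (Y × Y)} (F : EdgeFun E) : ℝ :=
  (perronPair (toMatrix F)).1

/-- The right Perron–Frobenius eigenvector `v_F`. -/
def perronVec {Y : Type*} [Fintype Y] [DecidableEq Y] {E : Finset (Y × Y)} (F : EdgeFun E) :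
    Y → ℝ :=
  (perronPair (toMatrix F)).2

/-- The normalization `s(F)(y, y') = F(y, y') v_F(y') / (ρ_F v_F(y))`. -/
def sNorm {Y : Type*} [Fintype Y] [DecidableEq Y] {E : Finset (Y × Y)} (F : EdgeFun E) :
    EdgeFun E :=
  fun e => F e * perronVec F e.1.2 / (perronRoot F * perronVec F e.1.1)

/-! ## Exponential families and exponential hulls -/

/-- `N(Y, E)`: the functions of the form `(y, y') ↦ f(y') - f(y) + c`. -/
def antiShift {Y : Type*} (E : Finset (Y × Y)) : Submodule ℝ (EdgeFun E) where
  carrier := {N | ∃ (c : ℝ) (f : Y → ℝ), ∀ e : E, N e = f e.1.2 - f e.1.1 + c}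
  zero_mem' := ⟨0, 0, fun e => by simp⟩
  add_mem' := by
    rintro _ _ ⟨c, f, h⟩ ⟨c', f', h'⟩
    exact ⟨c + c', f + f', fun e => by simp only [Pi.add_apply, h, h']; ring⟩
  smul_mem' := by
    rintro a _ ⟨c, f, h⟩
    exact ⟨a * c, a • f, fun e => by simp only [Pi.smul_apply, smul_eq_mul, h]; ring⟩

/-- `V` is an e-family: `V = {s(exp(K + ∑ θⁱ Gᵢ)) : θ ∈ ℝᵈ}` for some `d`, some `K` and some
`G₁, …, G_d` whose classes in `F(Y, E) / N(Y, E)` are linearly independent. -/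
def IsEFamily {Y : Type*} [Fintype Y] [DecidableEq Y] {E : Finset (Y × Y)}
    (V : Set (EdgeFun E)) : Prop :=
  ∃ (d : ℕ) (K : EdgeFun E) (G : Fin d → EdgeFun E),
    LinearIndependent ℝ (fun i => (antiShift E).mkQ (G i)) ∧
    V = Set.range fun θ : Fin d → ℝ => sNorm (expE (K + ∑ i, θ i • G i))

/-- The exponential hull of `V`. -/
def eHull {Y : Type*} [Fintype Y] [DecidableEq Y] {E : Finset (Y × Y)}
    (V : Set (EdgeFun E)) : Set (EdgeFun E) :=
  {Q | ∃ (k : ℕ) (α : Fin k → ℝ) (P : Fin k → EdgeFun E),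
    ∑ i, α i = 1 ∧ (∀ i, P i ∈ V) ∧
    ∃ R ∈ positiveEdgeFun E, logE R = ∑ i, α i • logE (P i) ∧ Q = sNorm R}

/-! ## Embedded submanifolds -/

/-- `S` is a smooth embedded submanifold without boundary, of dimension `d`, of the normed space
`M`: near each of its points a diffeomorphism between open subsets of `M` carries `S` to a
`d`-dimensional linear subspace. -/
def IsSubmanifoldOfDim {M : Type*} [NormedAddCommGroup M] [NormedSpace ℝ M] (d : ℕ) (S : Set M) :
    Prop :=
  ∀ p ∈ S, ∃ (Φ : OpenPartialHomeomorph M M) (L : Submodule ℝ M),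
    p ∈ Φ.source ∧ ContDiffOn ℝ ∞ Φ Φ.source ∧ ContDiffOn ℝ ∞ Φ.symm Φ.target ∧
    Module.finrank ℝ L = d ∧ ∀ x ∈ Φ.source, x ∈ S ↔ Φ x ∈ L

/-- `S` is a smooth embedded submanifold without boundary. The set `W(Y, E)` is one in `F(Y, E)`,
so for its subsets it is the same to be a submanifold of `W(Y, E)` or of `F(Y, E)`. -/
def IsSubmanifold {M : Type*} [NormedAddCommGroup M] [NormedSpace ℝ M] (S : Set M) : Prop :=
  ∃ d, IsSubmanifoldOfDim d S

/-- The dimension of a nonempty submanifold: `sInf` picks out the only element of the set. -/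
def manifoldDim {M : Type*} [NormedAddCommGroup M] [NormedSpace ℝ M] (S : Set M) : ℕ :=
  sInf {d | IsSubmanifoldOfDim d S}

end

end MarkovEFamily

/-!
Write `Z = F(Y, E) / N(Y, E)` and send a stochastic matrix `P` to the class of `log P` in `Z`. The
maximum principle on a strongly connected digraph shows that this map is injective on `W(Y, E)`
(`eq_of_mkQ_logE_eq`), and the Perron–Frobenius theorem, proved by the Collatz–Wielandt argument,
shows that the normalization `s` provides an inverse (`mkQ_logE_sNorm`). In these coordinates the
exponential hull of `V` is the affine span of the classes of `V` (`eHull_eq_setOf`), and the set of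
stochastic matrices over any affine subspace of `Z` is an e-family (`isEFamily_setOf_class_mem`). So
it suffices to show that `V` is equal to its exponential hull.

Smoothness of the Perron eigenvector is not needed. The map
`F ↦ (class of log F, row sums of F)` from `F⁺(Y, E)` to `Z × ℝ^Y` has invertible derivative
everywhere, again by the maximum principle and by `dim N(Y, E) ≥ |Y|`
(`exists_equiv_hasFDerivAt_chartMap`). It straightens the exponential hull, which is therefore a
submanifold, and it shows that the inverse `Z → W(Y, E)` is continuous (`continuous_classSection`).

By hypothesis `V` and its exponential hull have the same dimension, so `V` is open in the hull
(`IsSubmanifoldOfDim.mem_nhdsWithin`). The linear equation cutting out `V` makes `V` closed in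
`W(Y, E)`, hence in the hull. Being the continuous image of an affine subspace of `Z`, the hull is
connected, so it coincides with `V` (`eq_setOf_class_mem`).
-/

namespace MarkovEFamily

/-! ### Perron–Frobenius eigenpairs -/

section Perron

variable {Y : Type*} [Fintype Y] {A : Matrix Y Y ℝ}

theorem mulVec_pos_of_pos {B : Matrix Y Y ℝ} (hB : ∀ i j, 0 < B i j) {w : Y → ℝ}
    (hw : ∀ y, 0 ≤ w y) (hw0 : ∃ y, w y ≠ 0) (y : Y) : 0 < (B *ᵥ w) y := by
  obtain ⟨z, hz⟩ := hw0
  exact Finset.sum_pos' (fun k _ => mul_nonneg (hB y k).le (hw k))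
    ⟨z, Finset.mem_univ _, mul_pos (hB y z) (lt_of_le_of_ne (hw z) (Ne.symm hz))⟩

variable [DecidableEq Y]

/-- Some power of `1 + A` is entrywise positive. The positive diagonal of `1 + A` makes the supports
of its powers increase, so one exponent serves all entries even if `A` is periodic. -/
theorem exists_one_add_pow_pos (hA : ∀ i j, 0 ≤ A i j)
    (hirr : ∀ i j, Relation.ReflTransGen (fun a b => 0 < A a b) i j) :
    ∃ m : ℕ, ∀ i j, 0 < ((1 + A) ^ m) i j := by
  have hone : ∀ i j, (1 : Matrix Y Y ℝ) i j ≤ (1 + A) i j := fun i j => by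
    simpa using hA i j
  have hone0 : ∀ i j, 0 ≤ (1 : Matrix Y Y ℝ) i j := fun i j => by
    rw [Matrix.one_apply]; split_ifs <;> simp
  have hB : ∀ i j, 0 ≤ (1 + A) i j := fun i j => (hone0 i j).trans (hone i j)
  have hpow : ∀ (m : ℕ) i j, 0 ≤ ((1 + A) ^ m) i j := by
    intro m
    induction m with
    | zero => simpa using hone0
    | succ m ih =>
      intro i j
      rw [pow_succ, Matrix.mul_apply]
      exact Finset.sum_nonneg fun k _ => mul_nonneg (ih i k) (hB k j)
  have hstep : ∀ (m : ℕ) i b c, 0 < ((1 + A) ^ m) i b → 0 < (1 + A) b c →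
      0 < ((1 + A) ^ (m + 1)) i c := by
    intro m i b c h1 h2
    rw [pow_succ, Matrix.mul_apply]
    exact Finset.sum_pos' (fun k _ => mul_nonneg (hpow m i k) (hB k c))
      ⟨b, Finset.mem_univ _, mul_pos h1 h2⟩
  have hdiag : ∀ i, 0 < (1 + A) i i := fun i =>
    lt_of_lt_of_le (by simp) (hone i i)
  have hmono : ∀ (k m : ℕ) i j, 0 < ((1 + A) ^ m) i j → 0 < ((1 + A) ^ (m + k)) i j := by
    intro k
    induction k with
    | zero => intro m i j h; simpa using h
    | succ k ih => intro m i j h; exact hstep _ i j j (ih m i j h) (hdiag j)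
  have hex : ∀ i j, ∃ m : ℕ, 0 < ((1 + A) ^ m) i j := by
    intro i j
    induction hirr i j with
    | refl => exact ⟨0, by simp⟩
    | @tail b c _ hbc ih =>
      obtain ⟨m, hm⟩ := ih
      exact ⟨m + 1, hstep m i b c hm (add_pos_of_nonneg_of_pos (hone0 b c) hbc)⟩
  choose m hm using hex
  refine ⟨Finset.univ.sup fun p : Y × Y => m p.1 p.2, fun i j => ?_⟩
  have hle : m i j ≤ Finset.univ.sup fun p : Y × Y => m p.1 p.2 :=
    Finset.le_sup (f := fun p : Y × Y => m p.1 p.2) (Finset.mem_univ (i, j))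
  obtain ⟨k, hk⟩ := Nat.exists_eq_add_of_le hle
  rw [hk]
  exact hmono k _ i j (hm i j)

/-- A positive eigenvector of a nonnegative matrix belongs to an eigenvalue that dominates the
modulus of every complex eigenvalue. -/
theorem norm_le_of_mem_spectrum (hA : ∀ i j, 0 ≤ A i j) {ρ : ℝ} {v : Y → ℝ} (hv : ∀ y, 0 < v y)
    (hAv : A *ᵥ v = ρ • v) {μ : ℂ} (hμ : μ ∈ spectrum ℂ (A.map (fun x : ℝ => (x : ℂ)))) :
    ‖μ‖ ≤ ρ := by
  rw [← Matrix.spectrum_toLin', ← Module.End.hasEigenvalue_iff_mem_spectrum] at hμ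
  obtain ⟨w, hw⟩ := hμ.exists_hasEigenvector
  have hweq : ∀ y, ∑ z, (A y z : ℂ) * w z = μ * w y := fun y => by
    have := congrFun hw.apply_eq_smul y
    simpa [Matrix.toLin'_apply, Matrix.mulVec, dotProduct] using this
  obtain ⟨z, hz⟩ := Function.ne_iff.mp hw.2
  -- The eigenvalue equation for `w` is compared with that for `v` where `‖w‖ / v` is maximal.
  obtain ⟨y, -, hy⟩ := Finset.exists_max_image Finset.univ (fun y => ‖w y‖ / v y)
    ⟨z, Finset.mem_univ z⟩
  set t := ‖w y‖ / v y with ht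
  have htpos : 0 < t := lt_of_lt_of_le (div_pos (norm_pos_iff.mpr hz) (hv z))
    (hy z (Finset.mem_univ z))
  have hwt : ∀ z, ‖w z‖ ≤ t * v z := fun z => (div_le_iff₀ (hv z)).mp (hy z (Finset.mem_univ z))
  have hwy : ‖w y‖ = t * v y := by rw [ht, div_mul_cancel₀ _ (hv y).ne']
  have h1 : ‖μ‖ * ‖w y‖ ≤ ∑ z, A y z * (t * v z) := by
    rw [← norm_mul, ← hweq y]
    refine (norm_sum_le _ _).trans (Finset.sum_le_sum fun z _ => ?_)
    rw [norm_mul, Complex.norm_real, Real.norm_of_nonneg (hA y z)]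
    exact mul_le_mul_of_nonneg_left (hwt z) (hA y z)
  have h2 : ∑ z, A y z * (t * v z) = ρ * (t * v y) := by
    have := congrFun hAv y
    simp only [Matrix.mulVec, dotProduct, Pi.smul_apply, smul_eq_mul] at this
    rw [mul_left_comm, ← this, Finset.mul_sum]
    exact Finset.sum_congr rfl fun z _ => by ring
  rw [hwy, h2] at h1
  exact le_of_mul_le_mul_right h1 (mul_pos htpos (hv y))

/-- Collatz–Wielandt: among all `x` in the simplex and `r ≥ 0` with `r x ≤ A x`, a pair with maximal
`r` exists by compactness; a positive matrix commuting with `A` shows that it is an eigenpair. -/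
theorem exists_pos_eigenvector (hA : ∀ i j, 0 ≤ A i j)
    (hirr : ∀ i j, Relation.ReflTransGen (fun a b => 0 < A a b) i j) :
    ∃ (ρ : ℝ) (v : Y → ℝ), (∀ y, 0 < v y) ∧ A *ᵥ v = ρ • v := by
  rcases isEmpty_or_nonempty Y with hY | ⟨⟨y₀⟩⟩
  · exact ⟨0, 0, fun y => hY.elim y, funext fun y => hY.elim y⟩
  obtain ⟨m, hm⟩ := exists_one_add_pow_pos hA hirr
  set B := (1 + A) ^ m with hBdef
  have hcomm : A * B = B * A :=
    (((Commute.one_right A).add_right (Commute.refl A)).pow_right m).eq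
  set M := ∑ i, ∑ j, A i j with hM
  -- The constraint alone bounds `r`.
  have hbound : ∀ x ∈ stdSimplex ℝ Y, ∀ r : ℝ, (∀ y, r * x y ≤ (A *ᵥ x) y) → r ≤ M := by
    intro x hx r hr
    calc r = ∑ y, r * x y := by rw [← Finset.mul_sum, hx.2, mul_one]
      _ ≤ ∑ y, (A *ᵥ x) y := Finset.sum_le_sum fun y _ => hr y
      _ ≤ M := Finset.sum_le_sum fun y _ => Finset.sum_le_sum fun z _ =>
        mul_le_of_le_one_right (hA y z)
          (hx.2 ▸ Finset.single_le_sum (fun k _ => hx.1 k) (Finset.mem_univ z))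
  let S : Set ((Y → ℝ) × ℝ) :=
    (stdSimplex ℝ Y ×ˢ Set.Icc 0 M) ∩ {p | ∀ y, p.2 * p.1 y ≤ (A *ᵥ p.1) y}
  have hSc : IsCompact S := by
    refine ((isCompact_stdSimplex ℝ Y).prod isCompact_Icc).inter_right ?_
    rw [Set.ofPred_forall]
    refine isClosed_iInter fun y => isClosed_le (by fun_prop) ?_
    simp only [Matrix.mulVec, dotProduct]
    fun_prop
  have hM0 : 0 ≤ M := Finset.sum_nonneg fun i _ => Finset.sum_nonneg fun j _ => hA i j
  have hSne : S.Nonempty := by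
    refine ⟨(Pi.single y₀ 1, 0), ⟨single_mem_stdSimplex ℝ y₀, le_rfl, hM0⟩, fun y => ?_⟩
    simp only [zero_mul, Matrix.mulVec, dotProduct]
    exact Finset.sum_nonneg fun z _ => mul_nonneg (hA y z)
      ((single_mem_stdSimplex ℝ y₀).1 z)
  obtain ⟨⟨x, r⟩, ⟨⟨hx, hr⟩, hxr⟩, hmax⟩ := hSc.exists_isMaxOn hSne continuous_snd.continuousOn
  simp only at hx hr
  have hxr : ∀ y, r * x y ≤ (A *ᵥ x) y := hxr
  have hx0 : ∃ y, x y ≠ 0 := by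
    by_contra! h
    have := hx.2
    simp [h] at this
  have hBx : ∀ y, 0 < (B *ᵥ x) y := mulVec_pos_of_pos hm hx.1 hx0
  have hABx : A *ᵥ (B *ᵥ x) = B *ᵥ (A *ᵥ x) := by
    rw [Matrix.mulVec_mulVec, hcomm, ← Matrix.mulVec_mulVec]
  have heq : A *ᵥ x = r • x := by
    by_contra hne
    -- Otherwise `A (B x) - r (B x) = B (A x - r x)` is strictly positive, so that `r` can be
    -- enlarged after replacing `x` by `B x`.
    set w := A *ᵥ x - r • x with hw
    have hwpos : ∀ y, 0 < (B *ᵥ w) y := by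
      refine mulVec_pos_of_pos hm (fun y => ?_) ?_
      · simpa [hw] using hxr y
      · by_contra! h
        exact hne (sub_eq_zero.mp (funext h))
    have hBw : B *ᵥ w = A *ᵥ (B *ᵥ x) - r • (B *ᵥ x) := by
      rw [hw, Matrix.mulVec_sub, Matrix.mulVec_smul, hABx]
    obtain ⟨y₁, -, hy₁⟩ := Finset.exists_min_image Finset.univ
      (fun y => (B *ᵥ w) y / (B *ᵥ x) y) ⟨y₀, Finset.mem_univ y₀⟩
    set ε := (B *ᵥ w) y₁ / (B *ᵥ x) y₁ with hε
    have hεpos : 0 < ε := div_pos (hwpos y₁) (hBx y₁)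
    have hlarger : ∀ y, (r + ε) * (B *ᵥ x) y ≤ (A *ᵥ (B *ᵥ x)) y := by
      intro y
      have h1 := (le_div_iff₀ (hBx y)).mp (hy₁ y (Finset.mem_univ y))
      have h2 := congrFun hBw y
      simp only [Pi.sub_apply, Pi.smul_apply, smul_eq_mul] at h2
      linarith
    set s := ∑ y, (B *ᵥ x) y with hs
    have hspos : 0 < s := Finset.sum_pos (fun y _ => hBx y) ⟨y₀, Finset.mem_univ y₀⟩
    have hmem : s⁻¹ • (B *ᵥ x) ∈ stdSimplex ℝ Y := by
      refine ⟨fun y => mul_nonneg (inv_nonneg.mpr hspos.le) (hBx y).le, ?_⟩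
      simp only [Pi.smul_apply, smul_eq_mul]
      rw [← Finset.mul_sum, ← hs, inv_mul_cancel₀ hspos.ne']
    have hineq : ∀ y, (r + ε) * (s⁻¹ • (B *ᵥ x)) y ≤ (A *ᵥ (s⁻¹ • (B *ᵥ x))) y := by
      intro y
      rw [Matrix.mulVec_smul, Pi.smul_apply, Pi.smul_apply, smul_eq_mul, smul_eq_mul,
        mul_left_comm]
      exact mul_le_mul_of_nonneg_left (hlarger y) (inv_nonneg.mpr hspos.le)
    have hin : (s⁻¹ • (B *ᵥ x), r + ε) ∈ S :=
      ⟨⟨hmem, by linarith [hr.1], hbound _ hmem _ hineq⟩, hineq⟩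
    have := hmax hin
    simp only [Set.mem_ofPred_eq] at this
    linarith
  refine ⟨r, B *ᵥ x, hBx, ?_⟩
  rw [hABx, heq, Matrix.mulVec_smul]

/-- The choice made in `perronPair` is a genuine Perron–Frobenius eigenpair. -/
theorem isPerronPair_perronPair (hA : ∀ i j, 0 ≤ A i j)
    (hirr : ∀ i j, Relation.ReflTransGen (fun a b => 0 < A a b) i j) :
    IsPerronPair A (perronPair A).1 (perronPair A).2 := by
  obtain ⟨ρ, v, hv, hAv⟩ := exists_pos_eigenvector hA hirr
  exact Classical.epsilon_spec (p := fun p : ℝ × (Y → ℝ) => IsPerronPair A p.1 p.2)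
    ⟨(ρ, v), hv, hAv, fun μ hμ => norm_le_of_mem_spectrum hA hv hAv hμ⟩

end Perron

/-! ### The normalization -/

section Normalization

variable {Y : Type*} {E : Finset (Y × Y)}

theorem expE_mem_positiveEdgeFun (G : EdgeFun E) : expE G ∈ positiveEdgeFun E :=
  fun e => Real.exp_pos (G e)

theorem logE_expE (G : EdgeFun E) : logE (expE G) = G := funext fun e => Real.log_exp (G e)

variable [DecidableEq Y]

theorem toMatrix_apply_of_mem (F : EdgeFun E) {y y' : Y} (h : (y, y') ∈ E) :
    toMatrix F y y' = F ⟨(y, y'), h⟩ := by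
  simp [toMatrix, h]

theorem toMatrix_apply_of_notMem (F : EdgeFun E) {y y' : Y} (h : (y, y') ∉ E) :
    toMatrix F y y' = 0 := by
  simp [toMatrix, h]

theorem toMatrix_nonneg {F : EdgeFun E} (hF : F ∈ positiveEdgeFun E) (y y' : Y) :
    0 ≤ toMatrix F y y' := by
  by_cases h : (y, y') ∈ E
  · rw [toMatrix_apply_of_mem F h]; exact (hF _).le
  · rw [toMatrix_apply_of_notMem F h]

theorem toMatrix_pos {F : EdgeFun E} (hF : F ∈ positiveEdgeFun E) {y y' : Y} (h : (y, y') ∈ E) :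
    0 < toMatrix F y y' := by
  rw [toMatrix_apply_of_mem F h]; exact hF _

variable [Fintype Y]

theorem exists_edge_of_mem_stochasticFamily {P : EdgeFun E} (hP : P ∈ stochasticFamily E) (y : Y) :
    ∃ y', (y, y') ∈ E := by
  by_contra! h
  have := hP.2 y
  simp [toMatrix_apply_of_notMem P (h _)] at this

variable {F : EdgeFun E}

theorem isPerronPair_perronRoot (hE : StronglyConnected E) (hF : F ∈ positiveEdgeFun E) :
    IsPerronPair (toMatrix F) (perronRoot F) (perronVec F) :=
  isPerronPair_perronPair (toMatrix_nonneg hF) fun i j =>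
    Relation.ReflTransGen.mono (fun _ _ h => toMatrix_pos hF h) i j (hE i j)

theorem perronRoot_pos (hE : StronglyConnected E) (hF : F ∈ positiveEdgeFun E)
    {y y' : Y} (h : (y, y') ∈ E) : 0 < perronRoot F := by
  obtain ⟨hv, hAv, -⟩ := isPerronPair_perronRoot hE hF
  have h1 : 0 < (toMatrix F *ᵥ perronVec F) y :=
    Finset.sum_pos' (fun k _ => mul_nonneg (toMatrix_nonneg hF y k) (hv k).le)
      ⟨y', Finset.mem_univ _, mul_pos (toMatrix_pos hF h) (hv y')⟩
  rw [hAv] at h1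
  exact pos_of_mul_pos_left h1 (hv y).le

theorem sNorm_mem_stochasticFamily (hE : StronglyConnected E) (hrow : ∀ y, ∃ y', (y, y') ∈ E)
    (hF : F ∈ positiveEdgeFun E) : sNorm F ∈ stochasticFamily E := by
  obtain ⟨hv, hAv, -⟩ := isPerronPair_perronRoot hE hF
  refine ⟨fun e => div_pos (mul_pos (hF e) (hv _))
    (mul_pos (perronRoot_pos hE hF e.2) (hv _)), fun y => ?_⟩
  obtain ⟨y', hy'⟩ := hrow y
  have hρ := perronRoot_pos hE hF hy'
  have hentry : ∀ z, toMatrix (sNorm F) y z =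
      toMatrix F y z * perronVec F z / (perronRoot F * perronVec F y) := by
    intro z
    by_cases h : (y, z) ∈ E
    · rw [toMatrix_apply_of_mem _ h, toMatrix_apply_of_mem _ h]; rfl
    · rw [toMatrix_apply_of_notMem _ h, toMatrix_apply_of_notMem _ h]; simp
  have h1 : ∑ z, toMatrix F y z * perronVec F z = perronRoot F * perronVec F y := congrFun hAv y
  simp only [hentry]
  rw [← Finset.sum_div, h1, div_self (mul_pos hρ (hv y)).ne']

/-- Normalization adds to the logarithm the function `log v(y') - log v(y) - log ρ`. -/
theorem mkQ_logE_sNorm (hE : StronglyConnected E) (hF : F ∈ positiveEdgeFun E) :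
    (antiShift E).mkQ (logE (sNorm F)) = (antiShift E).mkQ (logE F) := by
  obtain ⟨hv, -, -⟩ := isPerronPair_perronRoot hE hF
  rw [Submodule.mkQ_apply, Submodule.mkQ_apply, Submodule.Quotient.eq]
  refine ⟨-Real.log (perronRoot F), fun y => Real.log (perronVec F y), fun e => ?_⟩
  have hρ := perronRoot_pos hE hF e.2
  simp only [Pi.sub_apply, logE, sNorm]
  rw [Real.log_div (mul_pos (hF e) (hv _)).ne' (mul_pos hρ (hv _)).ne',
    Real.log_mul (hF e).ne' (hv _).ne', Real.log_mul hρ.ne' (hv _).ne']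
  ring

end Normalization

/-! ### The maximum principle -/

section MaximumPrinciple

variable {Y : Type*} [Fintype Y] [DecidableEq Y] {E : Finset (Y × Y)} {F : EdgeFun E}

/-- Subharmonic functions on a finite strongly connected weighted digraph are constant. -/
theorem eq_of_subharmonic (hE : StronglyConnected E) (hF : F ∈ positiveEdgeFun E) {v : Y → ℝ}
    (hv : ∀ y, 0 ≤ ∑ z, toMatrix F y z * (v z - v y)) (y z : Y) : v y = v z := by
  obtain ⟨x, -, hx⟩ := Finset.exists_max_image Finset.univ v ⟨y, Finset.mem_univ y⟩
  have hx : ∀ w, v w ≤ v x := fun w => hx w (Finset.mem_univ w)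
  suffices h : ∀ w, v w = v x by rw [h y, h z]
  intro w
  induction hE x w with
  | refl => rfl
  | @tail b c _ hbc ih =>
    by_contra hne
    have hlt : v c - v b < 0 := sub_neg.mpr (ih ▸ lt_of_le_of_ne (hx c) hne)
    have : ∑ z, toMatrix F b z * (v z - v b) < 0 :=
      Finset.sum_neg' (fun z _ => mul_nonpos_of_nonneg_of_nonpos (toMatrix_nonneg hF b z)
        (sub_nonpos.mpr (ih ▸ hx z)))
        ⟨c, Finset.mem_univ c, mul_neg_of_pos_of_neg (toMatrix_pos hF hbc) hlt⟩
    exact absurd (hv b) this.not_ge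

theorem eq_of_subharmonic_or_superharmonic (hE : StronglyConnected E) (hF : F ∈ positiveEdgeFun E)
    {v : Y → ℝ}
    (hv : (∀ y, 0 ≤ ∑ z, toMatrix F y z * (v z - v y)) ∨
      ∀ y, ∑ z, toMatrix F y z * (v z - v y) ≤ 0) (y z : Y) : v y = v z := by
  rcases hv with hv | hv
  · exact eq_of_subharmonic hE hF hv y z
  · refine neg_injective (eq_of_subharmonic hE hF (v := -v) (fun x => ?_) y z)
    have h : ∑ z, toMatrix F x z * ((-v) z - (-v) x) = -∑ z, toMatrix F x z * (v z - v x) := by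
      rw [← Finset.sum_neg_distrib]
      exact Finset.sum_congr rfl fun z _ => by simp only [Pi.neg_apply]; ring
    rw [h]
    exact neg_nonneg.mpr (hv x)

theorem sum_toMatrix_pos (hF : F ∈ positiveEdgeFun E) {y y' : Y} (h : (y, y') ∈ E) :
    0 < ∑ z, toMatrix F y z :=
  Finset.sum_pos' (fun z _ => toMatrix_nonneg hF y z) ⟨y', Finset.mem_univ _, toMatrix_pos hF h⟩

/-- If a constant plus a gradient has vanishing weighted row sums, then both parts are trivial. -/
theorem eq_and_eq_zero_of_sum_eq_zero (hE : StronglyConnected E) (hrow : ∀ y, ∃ y', (y, y') ∈ E)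
    (hF : F ∈ positiveEdgeFun E) {f : Y → ℝ} {c : ℝ}
    (h : ∀ y, ∑ z, toMatrix F y z * (f z - f y + c) = 0) (y z : Y) : f y = f z ∧ c = 0 := by
  have hsum : ∀ y, ∑ z, toMatrix F y z * (f z - f y) = -c * ∑ z, toMatrix F y z := by
    intro y
    have := h y
    simp only [mul_add, Finset.sum_add_distrib] at this
    rw [← Finset.sum_mul] at this
    linarith
  have hpos : ∀ y, 0 < ∑ z, toMatrix F y z := fun y =>
    let ⟨_, h⟩ := hrow y
    sum_toMatrix_pos hF h
  have hf : ∀ y z, f y = f z := by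
    refine eq_of_subharmonic_or_superharmonic hE hF ?_
    simp only [hsum]
    rcases le_total c 0 with hc | hc
    · exact Or.inl fun y => mul_nonneg (neg_nonneg.mpr hc) (hpos y).le
    · exact Or.inr fun y => mul_nonpos_of_nonpos_of_nonneg (neg_nonpos.mpr hc) (hpos y).le
  refine ⟨hf y z, ?_⟩
  have h0 := hsum y
  simp only [hf _ y, sub_self, mul_zero, Finset.sum_const_zero] at h0
  simpa [(hpos y).ne'] using h0.symm

/-- A stochastic matrix is determined by the class of its logarithm: two representatives differ by a
change of the positive right eigenvector, which is constant by the maximum principle. -/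
theorem eq_of_mkQ_logE_eq (hE : StronglyConnected E) {P Q : EdgeFun E}
    (hP : P ∈ stochasticFamily E) (hQ : Q ∈ stochasticFamily E)
    (h : (antiShift E).mkQ (logE P) = (antiShift E).mkQ (logE Q)) : P = Q := by
  rw [Submodule.mkQ_apply, Submodule.mkQ_apply, Submodule.Quotient.eq] at h
  obtain ⟨c, f, hf⟩ := h
  have hPQ : ∀ e : E, P e = Q e * (Real.exp (f e.1.2) / Real.exp (f e.1.1) * Real.exp c) := by
    intro e
    have h1 : Real.log (P e) = Real.log (Q e) + (f e.1.2 - f e.1.1 + c) := by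
      have := hf e
      simp only [Pi.sub_apply, logE] at this
      linarith
    rw [← Real.exp_log (hP.1 e), h1, Real.exp_add, Real.exp_log (hQ.1 e), Real.exp_add,
      Real.exp_sub]
  set v : Y → ℝ := fun y => Real.exp (f y) with hv
  have hsum : ∀ y, ∑ z, toMatrix Q y z * (v z - v y) = v y * (Real.exp (-c) - 1) := by
    intro y
    have h1 : ∀ z, toMatrix Q y z * v z = toMatrix P y z * (v y * Real.exp (-c)) := by
      intro z
      by_cases hz : (y, z) ∈ E
      · rw [toMatrix_apply_of_mem _ hz, toMatrix_apply_of_mem _ hz, hPQ, Real.exp_neg]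
        field_simp
        simp [hv]
      · rw [toMatrix_apply_of_notMem _ hz, toMatrix_apply_of_notMem _ hz]; simp
    simp only [mul_sub, h1, Finset.sum_sub_distrib, ← Finset.sum_mul, hP.2 y, hQ.2 y]
    ring
  have hconst : ∀ y z, v y = v z := by
    refine eq_of_subharmonic_or_superharmonic hE hQ.1 ?_
    simp only [hsum]
    rcases le_total 0 (Real.exp (-c) - 1) with hc | hc
    · exact Or.inl fun y => mul_nonneg (Real.exp_pos _).le hc
    · exact Or.inr fun y => mul_nonpos_of_nonneg_of_nonpos (Real.exp_pos _).le hc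
  funext e
  have h0 := hsum e.1.1
  simp only [hconst _ e.1.1, sub_self, mul_zero, Finset.sum_const_zero] at h0
  have hc : c = 0 := by
    have : Real.exp (-c) - 1 = 0 :=
      (mul_eq_zero.mp h0.symm).resolve_left (Real.exp_pos _).ne'
    have := (Real.exp_eq_one_iff _).mp (sub_eq_zero.mp this)
    linarith
  rw [hPQ e, hc]
  change Q e * (v e.1.2 / v e.1.1 * Real.exp 0) = Q e
  rw [hconst e.1.2 e.1.1, div_self (Real.exp_pos _).ne']
  simp

end MaximumPrinciple

/-! ### Submanifolds of equal dimension -/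

section Submanifold

variable {M : Type*} [NormedAddCommGroup M] [NormedSpace ℝ M] [FiniteDimensional ℝ M]

/-- A submanifold contained in a submanifold of the same dimension is open in it: in charts, the
inclusion has injective derivative between spaces of equal dimension, so the inverse function
theorem applies. -/
theorem IsSubmanifoldOfDim.mem_nhdsWithin {d : ℕ} {S T : Set M} (hS : IsSubmanifoldOfDim d S)
    (hT : IsSubmanifoldOfDim d T) (hST : S ⊆ T) {p : M} (hp : p ∈ S) :
    S ∈ nhdsWithin p T := by
  have : CompleteSpace M := FiniteDimensional.complete ℝ M
  obtain ⟨Φ, L, hpΦ, hΦ, hΦs, hL, hSL⟩ := hS p hp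
  obtain ⟨X, K, hpX, hX, hXs, hK, hTK⟩ := hT p (hST hp)
  obtain ⟨k, hk⟩ := K.subtype.exists_leftInverse_of_injective K.ker_subtype
  let π : M →L[ℝ] K := LinearMap.toContinuousLinearMap k
  have hπ : ∀ x ∈ K, (π x : M) = x := fun x hx =>
    congrArg Subtype.val (LinearMap.congr_fun hk ⟨x, hx⟩)
  have hqL : Φ p ∈ L := (hSL p hpΦ).mp hp
  have hqt : Φ p ∈ Φ.target := Φ.map_source hpΦ
  have hsymm : Φ.symm (Φ p) = p := Φ.left_inv hpΦ
  -- The transition map and its derivative.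
  have hgs : ContDiffAt ℝ ∞ Φ.symm (Φ p) :=
    (hΦs _ hqt).contDiffAt (Φ.open_target.mem_nhds hqt)
  have hXp : ContDiffAt ℝ ∞ X p := (hX _ hpX).contDiffAt (X.open_source.mem_nhds hpX)
  have hg : ContDiffAt ℝ ∞ (fun x => X (Φ.symm x)) (Φ p) :=
    ContDiffAt.comp (g := X) (Φ p) (by rwa [hsymm]) hgs
  have hginj : Function.Injective (fderiv ℝ (fun x => X (Φ.symm x)) (Φ p)) := by
    have hXt : X p ∈ X.target := X.map_source hpX
    have hr1 : ContDiffAt ℝ ∞ X.symm (X p) :=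
      (hXs _ hXt).contDiffAt (X.open_target.mem_nhds hXt)
    have hr2 : ContDiffAt ℝ ∞ Φ p := (hΦ _ hpΦ).contDiffAt (Φ.open_source.mem_nhds hpΦ)
    have hr : ContDiffAt ℝ ∞ (fun x => Φ (X.symm x)) (X p) :=
      ContDiffAt.comp (g := Φ) (X p) (by rwa [X.left_inv hpX]) hr1
    have hrd : HasFDerivAt (fun x => Φ (X.symm x)) (fderiv ℝ (fun x => Φ (X.symm x)) (X p))
        (X (Φ.symm (Φ p))) := by
      rw [hsymm]; exact (hr.differentiableAt (by simp)).hasFDerivAt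
    have hcomp := hrd.comp (Φ p) (hg.differentiableAt (by simp)).hasFDerivAt
    have hid : (fun x => Φ (X.symm x)) ∘ (fun x => X (Φ.symm x)) =ᶠ[nhds (Φ p)] id := by
      have h1 : ∀ᶠ x in nhds (Φ p), Φ.symm x ∈ X.source :=
        hgs.continuousAt.eventually (X.open_source.mem_nhds (by rwa [hsymm]))
      filter_upwards [h1, Φ.open_target.mem_nhds hqt] with x hx hxt
      simp [X.left_inv hx, Φ.right_inv hxt]
    have huniq := (hcomp.congr_of_eventuallyEq hid.symm).unique (hasFDerivAt_id (Φ p))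
    intro x y hxy
    have hx := DFunLike.congr_fun huniq x
    have hy := DFunLike.congr_fun huniq y
    simp only [ContinuousLinearMap.comp_apply, ContinuousLinearMap.id_apply] at hx hy
    rw [← hx, ← hy, hxy]
  set g' := fderiv ℝ (fun x => X (Φ.symm x)) (Φ p) with hg'
  -- Read between the linear models `L` and `K`.
  let q : L := ⟨Φ p, hqL⟩
  let h : L → K := fun x => π (X (Φ.symm x))
  have hstrict : HasStrictFDerivAt h ((π.comp g').comp L.subtypeL) q := by
    have h1 : HasStrictFDerivAt (fun x => X (Φ.symm x)) g' (L.subtypeL q) :=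
      hg.hasStrictFDerivAt (by simp)
    exact (π.hasStrictFDerivAt.comp q (h1.comp q L.subtypeL.hasStrictFDerivAt))
  have hev : ∀ᶠ x : L in nhds q, Φ.symm x ∈ S ∧ Φ.symm x ∈ X.source ∧
      X (Φ.symm (x : M)) ∈ K := by
    have hc : ContinuousAt (fun x : L => (x : M)) q := continuous_subtype_val.continuousAt
    have h1 : ∀ᶠ x : L in nhds q, (x : M) ∈ Φ.target :=
      hc.eventually (Φ.open_target.mem_nhds hqt)
    have h2 : ∀ᶠ x : L in nhds q, Φ.symm x ∈ X.source :=
      hc.eventually (hgs.continuousAt.eventually (X.open_source.mem_nhds (by rwa [hsymm])))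
    filter_upwards [h1, h2] with x hx1 hx2
    have hxS : Φ.symm x ∈ S := by
      rw [hSL _ (Φ.map_target hx1), Φ.right_inv hx1]
      exact x.2
    exact ⟨hxS, hx2, (hTK _ hx2).mp (hST hxS)⟩
  -- Since `h` is the transition map on `L`, its derivative inherits injectivity.
  have hinj : Function.Injective ((π.comp g').comp L.subtypeL) := by
    have h1 : HasFDerivAt (fun x : L => ((h x : K) : M))
        (K.subtypeL.comp ((π.comp g').comp L.subtypeL)) q :=
      K.subtypeL.hasFDerivAt.comp q hstrict.hasFDerivAt
    have h2 : HasFDerivAt (fun x : L => X (Φ.symm (x : M))) (g'.comp L.subtypeL) q := by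
      have h3 : HasFDerivAt (fun x => X (Φ.symm x)) g' (L.subtypeL q) :=
        (hg.differentiableAt (by simp)).hasFDerivAt
      exact h3.comp q L.subtypeL.hasFDerivAt
    have heq : (fun x : L => ((h x : K) : M)) =ᶠ[nhds q] fun x : L => X (Φ.symm (x : M)) := by
      filter_upwards [hev] with x hx
      exact hπ _ hx.2.2
    have huniq := h1.unique (h2.congr_of_eventuallyEq heq)
    intro x y hxy
    have h4 : (g'.comp L.subtypeL) x = (g'.comp L.subtypeL) y := by
      rw [← huniq]
      exact congrArg K.subtypeL hxy
    exact Subtype.ext (hginj h4)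
  let e : L ≃L[ℝ] K := (LinearMap.linearEquivOfInjective
    ((π.comp g').comp L.subtypeL).toLinearMap hinj (hL.trans hK.symm)).toContinuousLinearEquiv
  have hstrict' : HasStrictFDerivAt h (e : L →L[ℝ] K) q := by
    convert! hstrict using 1
  have hmap := hstrict'.map_nhds_eq_of_equiv
  have himage := Filter.image_mem_map (m := h) hev
  rw [hmap] at himage
  have htend : Filter.Tendsto (fun t => π (X t)) (nhds p) (nhds (h q)) := by
    have : h q = π (X p) := by simp only [h, q, hsymm]
    rw [this]
    exact (π.continuous.continuousAt.comp hXp.continuousAt)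
  rw [mem_nhdsWithin_iff_eventually]
  filter_upwards [htend himage, X.open_source.mem_nhds hpX] with t ht htX htT
  obtain ⟨x, ⟨hxS, hxX, hxK⟩, hxt⟩ := ht
  have h1 : X (Φ.symm (x : M)) = X t := by
    rw [← hπ _ hxK, ← hπ _ ((hTK _ htX).mp htT)]
    exact congrArg Subtype.val hxt
  rwa [← X.injOn hxX htX h1]

end Submanifold

/-! ### The local diffeomorphism given by logarithmic classes and row sums -/

section Chart

variable {Y : Type*} {E : Finset (Y × Y)}

instance isClosed_antiShift (E : Finset (Y × Y)) : IsClosed (antiShift E : Set (EdgeFun E)) :=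
  Submodule.closed_of_finiteDimensional _

/-- The parametrization `(f, c) ↦ ((y, y') ↦ f(y') - f(y) + c)` of `N(Y, E)`. -/
def shiftMap (E : Finset (Y × Y)) : (Y → ℝ) × ℝ →ₗ[ℝ] EdgeFun E where
  toFun p := fun e => p.1 e.1.2 - p.1 e.1.1 + p.2
  map_add' p q := funext fun e => by simp only [Prod.fst_add, Prod.snd_add, Pi.add_apply]; ring
  map_smul' a p := funext fun e => by
    simp only [Prod.smul_fst, Prod.smul_snd, Pi.smul_apply, smul_eq_mul, RingHom.id_apply]; ring

theorem range_shiftMap (E : Finset (Y × Y)) : LinearMap.range (shiftMap E) = antiShift E := by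
  ext N
  constructor
  · rintro ⟨⟨f, c⟩, rfl⟩
    exact ⟨c, f, fun e => rfl⟩
  · rintro ⟨c, f, h⟩
    exact ⟨(f, c), funext fun e => (h e).symm⟩

theorem isOpen_positiveEdgeFun : IsOpen (positiveEdgeFun E) := by
  have h : positiveEdgeFun E = ⋂ e, {F : EdgeFun E | 0 < F e} := by ext F; simp [positiveEdgeFun]
  rw [h]
  exact isOpen_iInter_of_finite fun e => isOpen_lt continuous_const (continuous_apply e)

/-- The projection `F(Y, E) → F(Y, E) / N(Y, E)` as a continuous linear map. -/
noncomputable def mkQL (E : Finset (Y × Y)) : EdgeFun E →L[ℝ] EdgeFun E ⧸ antiShift E :=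
  LinearMap.toContinuousLinearMap (antiShift E).mkQ

variable [Fintype Y] [DecidableEq Y]

/-- The row sums of a function on the edges. -/
noncomputable def rowSum (E : Finset (Y × Y)) : EdgeFun E →L[ℝ] (Y → ℝ) :=
  LinearMap.toContinuousLinearMap
    { toFun := fun F y => ∑ z, toMatrix F y z
      map_add' := fun F G => funext fun y => by
        rw [Pi.add_apply, ← Finset.sum_add_distrib]
        refine Finset.sum_congr rfl fun z _ => ?_
        by_cases h : (y, z) ∈ E <;> simp [toMatrix, h]
      map_smul' := fun a F => funext fun y => by
        rw [Pi.smul_apply, RingHom.id_apply, smul_eq_mul, Finset.mul_sum]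
        refine Finset.sum_congr rfl fun z _ => ?_
        by_cases h : (y, z) ∈ E <;> simp [toMatrix, h] }

theorem rowSum_apply (F : EdgeFun E) (y : Y) : rowSum E F y = ∑ z, toMatrix F y z := rfl

theorem mem_stochasticFamily_iff {F : EdgeFun E} :
    F ∈ stochasticFamily E ↔ F ∈ positiveEdgeFun E ∧ rowSum E F = 1 :=
  and_congr_right fun _ => funext_iff.symm

/-- `N(Y, E)` has dimension at least `|Y|`: the kernel of its parametrization consists of the
constant `f` with `c = 0`. -/
theorem card_le_finrank_antiShift (hE : StronglyConnected E) (hrow : ∀ y, ∃ y', (y, y') ∈ E) :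
    Fintype.card Y ≤ Module.finrank ℝ (antiShift E) := by
  rcases isEmpty_or_nonempty Y with hY | ⟨⟨y₀⟩⟩
  · simp
  have hker : LinearMap.ker (shiftMap E) ≤ Submodule.span ℝ {((1 : Y → ℝ), (0 : ℝ))} := by
    rintro ⟨f, c⟩ hp
    have hp : ∀ e : E, f e.1.2 - f e.1.1 + c = 0 := congrFun (LinearMap.mem_ker.mp hp)
    have hone : (fun _ => 1 : EdgeFun E) ∈ positiveEdgeFun E := fun _ => one_pos
    have key := eq_and_eq_zero_of_sum_eq_zero hE hrow hone (f := f) (c := c) fun y =>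
      Finset.sum_eq_zero fun z _ => by
        by_cases h : (y, z) ∈ E
        · rw [hp ⟨(y, z), h⟩, mul_zero]
        · rw [toMatrix_apply_of_notMem _ h, zero_mul]
    rw [Submodule.mem_span_singleton]
    refine ⟨f y₀, Prod.ext (funext fun y => ?_) ?_⟩
    · simp [(key y y₀).1]
    · simp [(key y₀ y₀).2]
  have h1 := LinearMap.finrank_range_add_finrank_ker (shiftMap E)
  have h2 := (Submodule.finrank_mono hker).trans (finrank_span_le_card _)
  rw [range_shiftMap, Module.finrank_prod, Module.finrank_self, Module.finrank_fintype_fun_eq_card]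
    at h1
  simp only [Set.toFinset_singleton, Finset.card_singleton] at h2
  omega

/-- A function on the edges is sent to the class of its logarithm and to its row sums. -/
noncomputable def chartMap (F : EdgeFun E) : (EdgeFun E ⧸ antiShift E) × (Y → ℝ) :=
  (mkQL E (logE F), rowSum E F)

theorem contDiffAt_chartMap {F : EdgeFun E} (hF : F ∈ positiveEdgeFun E) :
    ContDiffAt ℝ ∞ (chartMap (E := E)) F := by
  refine ContDiffAt.prodMk ((mkQL E).contDiff.contDiffAt.comp F ?_) (rowSum E).contDiff.contDiffAt
  exact contDiffAt_pi.mpr fun e => (contDiffAt_apply ℝ ℝ e F).log (hF e).ne'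

/-- The derivative of the entrywise logarithm. -/
noncomputable def logEDeriv (F : EdgeFun E) : EdgeFun E →L[ℝ] EdgeFun E :=
  ContinuousLinearMap.pi fun e => (F e)⁻¹ • ContinuousLinearMap.proj e

theorem hasFDerivAt_chartMap {F : EdgeFun E} (hF : F ∈ positiveEdgeFun E) :
    HasFDerivAt (chartMap (E := E)) (((mkQL E).comp (logEDeriv F)).prod (rowSum E)) F := by
  refine HasFDerivAt.prodMk ((mkQL E).hasFDerivAt.comp F ?_) (rowSum E).hasFDerivAt
  exact hasFDerivAt_pi.mpr fun e => (hasFDerivAt_apply e F).log (hF e).ne'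

theorem injective_chartMap_deriv (hE : StronglyConnected E) (hrow : ∀ y, ∃ y', (y, y') ∈ E)
    {F : EdgeFun E} (hF : F ∈ positiveEdgeFun E) :
    Function.Injective (((mkQL E).comp (logEDeriv F)).prod (rowSum E)) := by
  rw [injective_iff_map_eq_zero]
  intro X hX
  obtain ⟨h1, h2⟩ := Prod.ext_iff.mp hX
  obtain ⟨c, f, hf⟩ := (Submodule.Quotient.mk_eq_zero _).mp h1
  have hX : ∀ e : E, X e = F e * (f e.1.2 - f e.1.1 + c) := fun e => by
    rw [← hf e]
    change X e = F e * ((F e)⁻¹ * X e)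
    rw [mul_inv_cancel_left₀ (hF e).ne']
  have key := eq_and_eq_zero_of_sum_eq_zero hE hrow hF (f := f) (c := c) fun y => by
    rw [← show rowSum E X y = 0 from congrFun h2 y, rowSum_apply]
    refine Finset.sum_congr rfl fun z _ => ?_
    by_cases h : (y, z) ∈ E
    · rw [toMatrix_apply_of_mem _ h, toMatrix_apply_of_mem _ h, hX]
    · rw [toMatrix_apply_of_notMem _ h, toMatrix_apply_of_notMem _ h, zero_mul]
  funext e
  rw [hX e, (key e.1.2 e.1.1).1, (key e.1.2 e.1.1).2]
  simp

/-- The derivative of `chartMap` is invertible: it is injective by the maximum principle, and the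
dimensions agree. -/
theorem exists_equiv_hasFDerivAt_chartMap (hE : StronglyConnected E)
    (hrow : ∀ y, ∃ y', (y, y') ∈ E) {F : EdgeFun E} (hF : F ∈ positiveEdgeFun E) :
    ∃ D : EdgeFun E ≃L[ℝ] (EdgeFun E ⧸ antiShift E) × (Y → ℝ),
      HasFDerivAt (chartMap (E := E)) (D : EdgeFun E →L[ℝ] _) F := by
  have hinj := injective_chartMap_deriv hE hrow hF
  have hle := LinearMap.finrank_le_finrank_of_injective
    (f := (((mkQL E).comp (logEDeriv F)).prod (rowSum E)).toLinearMap) hinj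
  have hdim : Module.finrank ℝ (EdgeFun E) =
      Module.finrank ℝ ((EdgeFun E ⧸ antiShift E) × (Y → ℝ)) := by
    refine le_antisymm hle ?_
    have h1 := Submodule.finrank_quotient_add_finrank (antiShift E)
    have h2 := card_le_finrank_antiShift hE hrow
    rw [Module.finrank_prod, Module.finrank_fintype_fun_eq_card]
    omega
  refine ⟨(LinearMap.linearEquivOfInjective _ hinj hdim).toContinuousLinearEquiv, ?_⟩
  convert! hasFDerivAt_chartMap hF using 1

theorem map_nhds_chartMap (hE : StronglyConnected E) (hrow : ∀ y, ∃ y', (y, y') ∈ E)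
    {F : EdgeFun E} (hF : F ∈ positiveEdgeFun E) :
    Filter.map chartMap (nhds F) = nhds (chartMap F) := by
  obtain ⟨D, hD⟩ := exists_equiv_hasFDerivAt_chartMap hE hrow hF
  exact ((contDiffAt_chartMap hF).hasStrictFDerivAt' hD (by simp)).map_nhds_eq_of_equiv

/-- The stochastic matrices whose logarithmic class lies in a given affine subspace `a + D` form a
submanifold of dimension `dim D`: `chartMap` straightens it. -/
theorem isSubmanifoldOfDim_setOf_class_mem (hE : StronglyConnected E)
    (hrow : ∀ y, ∃ y', (y, y') ∈ E) (D : Submodule ℝ (EdgeFun E ⧸ antiShift E))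
    (a : EdgeFun E ⧸ antiShift E) :
    IsSubmanifoldOfDim (Module.finrank ℝ D)
      {Q | Q ∈ stochasticFamily E ∧ (antiShift E).mkQ (logE Q) - a ∈ D} := by
  rintro p ⟨hp, hpa⟩
  obtain ⟨T, hT⟩ := exists_equiv_hasFDerivAt_chartMap hE hrow hp.1
  have hp1 : rowSum E p = 1 := (mem_stochasticFamily_iff.mp hp).2
  -- `chartMap`, recentred at `p` and with its target identified with `F(Y, E)`
  let f : EdgeFun E → EdgeFun E := fun F => T.symm (chartMap F - chartMap p)
  have hf : ∀ F ∈ positiveEdgeFun E, ContDiffAt ℝ ∞ f F := fun F hF =>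
    T.symm.contDiff.contDiffAt.comp F ((contDiffAt_chartMap hF).sub contDiffAt_const)
  have hf' : ∀ F ∈ positiveEdgeFun E, ∃ S : EdgeFun E ≃L[ℝ] EdgeFun E,
      HasFDerivAt f (S : EdgeFun E →L[ℝ] EdgeFun E) F := by
    intro F hF
    obtain ⟨S, hS⟩ := exists_equiv_hasFDerivAt_chartMap hE hrow hF
    exact ⟨S.trans T.symm, T.symm.hasFDerivAt.comp F (hS.sub_const _)⟩
  obtain ⟨S, hS⟩ := hf' p hp.1
  let Φ₀ := (hf p hp.1).toOpenPartialHomeomorph f hS (by simp)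
  -- On positive functions the derivative is invertible everywhere, not only near `p`, which makes
  -- the inverse smooth on the whole target.
  let Φ := Φ₀.restrOpen (positiveEdgeFun E) isOpen_positiveEdgeFun
  have hΦf : (Φ : EdgeFun E → EdgeFun E) = f := rfl
  have hsrc : Φ.source = Φ₀.source ∩ positiveEdgeFun E := Φ₀.restrOpen_source _ _
  let L := (D.prod (⊥ : Submodule ℝ (Y → ℝ))).map T.symm.toLinearEquiv.toLinearMap
  refine ⟨Φ, L, ?_, ?_, ?_, ?_, ?_⟩
  · rw [hsrc]
    exact ⟨(hf p hp.1).mem_toOpenPartialHomeomorph_source hS (by simp), hp.1⟩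
  · rw [hsrc, hΦf]
    exact fun F hF => (hf F hF.2).contDiffWithinAt
  · intro G hG
    have hFsrc := Φ.map_target hG
    rw [hsrc] at hFsrc
    obtain ⟨S', hS'⟩ := hf' _ hFsrc.2
    exact (Φ.contDiffAt_symm hG hS' (hf _ hFsrc.2)).contDiffWithinAt
  · have h1 : Module.finrank ℝ L =
        Module.finrank ℝ (D.prod (⊥ : Submodule ℝ (Y → ℝ))) :=
      LinearEquiv.finrank_map_eq T.symm.toLinearEquiv _
    rw [h1, ← Submodule.map_inl]
    exact (Submodule.equivMapOfInjective _ LinearMap.inl_injective D).finrank_eq.symm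
  · intro F hF
    rw [hsrc] at hF
    have h1 : Φ F ∈ L ↔
        chartMap F - chartMap p ∈ D.prod (⊥ : Submodule ℝ (Y → ℝ)) := by
      constructor
      · rintro ⟨z, hz, hzF⟩
        rwa [← T.symm.injective hzF]
      · exact fun h => ⟨_, h, rfl⟩
    have h2 : rowSum E F - rowSum E p = 0 ↔ rowSum E F = 1 := by rw [sub_eq_zero, hp1]
    have h3 : (antiShift E).mkQ (logE F) - (antiShift E).mkQ (logE p) ∈ D ↔
        (antiShift E).mkQ (logE F) - a ∈ D := by
      rw [← sub_add_sub_cancel _ ((antiShift E).mkQ (logE p)) a, D.add_mem_iff_left hpa]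
    rw [h1, Submodule.mem_prod, Submodule.mem_bot]
    change (F ∈ stochasticFamily E ∧ _) ↔ ((antiShift E).mkQ (logE F) -
      (antiShift E).mkQ (logE p) ∈ D ∧ rowSum E F - rowSum E p = 0)
    rw [h2, h3, mem_stochasticFamily_iff]
    have := hF.2
    tauto

/-- The stochastic matrix whose logarithm has the given class: the normalization of the exponential
of any representative. -/
noncomputable def classSection (z : EdgeFun E ⧸ antiShift E) : EdgeFun E :=
  sNorm (expE z.out)

theorem classSection_mem (hE : StronglyConnected E) (hrow : ∀ y, ∃ y', (y, y') ∈ E)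
    (z : EdgeFun E ⧸ antiShift E) : classSection z ∈ stochasticFamily E :=
  sNorm_mem_stochasticFamily hE hrow (expE_mem_positiveEdgeFun _)

theorem mkQ_logE_classSection (hE : StronglyConnected E) (z : EdgeFun E ⧸ antiShift E) :
    (antiShift E).mkQ (logE (classSection z)) = z := by
  rw [classSection, mkQ_logE_sNorm hE (expE_mem_positiveEdgeFun _), logE_expE]
  exact Quotient.out_eq z

/-- The section is continuous because `chartMap` is open: a class near that of `P` is attained, with
unit row sums, at a point near `P`. -/
theorem continuous_classSection (hE : StronglyConnected E) (hrow : ∀ y, ∃ y', (y, y') ∈ E) :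
    Continuous (classSection (E := E)) := by
  rw [continuous_iff_continuousAt]
  intro z₀
  set p := classSection z₀ with hp
  have hpW := classSection_mem hE hrow z₀
  rw [← hp] at hpW
  have hchart : chartMap p = (z₀, 1) :=
    Prod.ext (mkQ_logE_classSection hE z₀) (mem_stochasticFamily_iff.mp hpW).2
  intro U hU
  have h1 : chartMap '' (U ∩ positiveEdgeFun E) ∈ nhds (z₀, (1 : Y → ℝ)) := by
    rw [← hchart, ← map_nhds_chartMap hE hrow hpW.1]
    exact Filter.image_mem_map
      (Filter.inter_mem hU (isOpen_positiveEdgeFun.mem_nhds hpW.1))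
  have h2 : Filter.Tendsto (fun z => (z, (1 : Y → ℝ))) (nhds z₀) (nhds (z₀, 1)) :=
    (Continuous.prodMk_left _).tendsto _
  rw [Filter.mem_map]
  filter_upwards [h2 h1] with z hz
  obtain ⟨F, ⟨hFU, hF⟩, hFz⟩ := hz
  obtain ⟨hF1, hF2⟩ := Prod.ext_iff.mp hFz
  have : classSection z = F := eq_of_mkQ_logE_eq hE (classSection_mem hE hrow z)
    (mem_stochasticFamily_iff.mpr ⟨hF, hF2⟩) ((mkQ_logE_classSection hE z).trans hF1.symm)
  rwa [Set.mem_preimage, this]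

end Chart

/-! ### The exponential hull -/

section Hull

variable {Y : Type*} [Fintype Y] [DecidableEq Y] {E : Finset (Y × Y)}

/-- The direction of the affine span of the logarithmic classes of `V`, relative to the class `a`
of a base point. -/
def classDirection (V : Set (EdgeFun E)) (a : EdgeFun E ⧸ antiShift E) :
    Submodule ℝ (EdgeFun E ⧸ antiShift E) :=
  Submodule.span ℝ ((fun P => (antiShift E).mkQ (logE P) - a) '' V)

/-- The exponential hull consists of the stochastic matrices whose logarithmic class lies in the
affine span of the logarithmic classes of `V`. -/
theorem eHull_eq_setOf (hE : StronglyConnected E) {V : Set (EdgeFun E)}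
    (hV : V ⊆ stochasticFamily E) {P₀ : EdgeFun E} (hP₀ : P₀ ∈ V) :
    eHull V = {Q | Q ∈ stochasticFamily E ∧ (antiShift E).mkQ (logE Q) -
      (antiShift E).mkQ (logE P₀) ∈ classDirection V ((antiShift E).mkQ (logE P₀))} := by
  have hrow := exists_edge_of_mem_stochasticFamily (hV hP₀)
  set a := (antiShift E).mkQ (logE P₀) with ha
  ext Q
  constructor
  · rintro ⟨k, α, P, hα, hP, R, hR, hlog, rfl⟩
    refine ⟨sNorm_mem_stochasticFamily hE hrow hR, ?_⟩
    have h : (antiShift E).mkQ (logE R) - a =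
        ∑ i, α i • ((antiShift E).mkQ (logE (P i)) - a) := by
      simp only [smul_sub, Finset.sum_sub_distrib, ← Finset.sum_smul, hα, one_smul, hlog, map_sum,
        map_smul]
    rw [mkQ_logE_sNorm hE hR, h]
    exact Submodule.sum_mem _ fun i _ => Submodule.smul_mem _ _
      (Submodule.subset_span ⟨P i, hP i, rfl⟩)
  · rintro ⟨hQ, hQa⟩
    obtain ⟨n, c, g, hg⟩ := Submodule.mem_span_set'.mp hQa
    choose P hPV hP using fun i => (g i).2
    -- The coefficients need not sum to one; the base point `P₀` takes up the difference.
    let α : Fin (n + 1) → ℝ := Fin.cons (1 - ∑ i, c i) c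
    let P' : Fin (n + 1) → EdgeFun E := Fin.cons P₀ P
    let R := expE (∑ i, α i • logE (P' i))
    have hR : R ∈ positiveEdgeFun E := expE_mem_positiveEdgeFun _
    refine ⟨n + 1, α, P', ?_, ?_, R, hR, logE_expE _, ?_⟩
    · simp [α, Fin.sum_univ_succ]
    · exact Fin.cases hP₀ hPV
    · refine eq_of_mkQ_logE_eq hE hQ (sNorm_mem_stochasticFamily hE hrow hR) ?_
      rw [mkQ_logE_sNorm hE hR, logE_expE, Fin.sum_univ_succ]
      simp only [α, P', Fin.cons_zero, Fin.cons_succ, map_add, map_sum, map_smul, ← ha]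
      rw [← sub_add_cancel ((antiShift E).mkQ (logE Q)) a, ← hg]
      simp only [← hP, smul_sub, Finset.sum_sub_distrib, ← Finset.sum_smul, sub_smul, one_smul]
      abel

/-- The set of stochastic matrices whose logarithmic class lies in a fixed affine subspace is an
e-family. -/
theorem isEFamily_setOf_class_mem (hE : StronglyConnected E) (hrow : ∀ y, ∃ y', (y, y') ∈ E)
    (D : Submodule ℝ (EdgeFun E ⧸ antiShift E)) (K : EdgeFun E) :
    IsEFamily {Q | Q ∈ stochasticFamily E ∧
      (antiShift E).mkQ (logE Q) - (antiShift E).mkQ K ∈ D} := by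
  let b := Module.finBasis ℝ D
  choose G hG using fun i => (antiShift E).mkQ_surjective (b i : EdgeFun E ⧸ antiShift E)
  have hclass : ∀ θ : Fin (Module.finrank ℝ D) → ℝ,
      (antiShift E).mkQ (logE (sNorm (expE (K + ∑ i, θ i • G i)))) - (antiShift E).mkQ K =
        ((∑ i, θ i • b i : D) : EdgeFun E ⧸ antiShift E) := by
    intro θ
    rw [mkQ_logE_sNorm hE (expE_mem_positiveEdgeFun _), logE_expE, map_add, add_sub_cancel_left]
    simp [← hG]
  refine ⟨Module.finrank ℝ D, K, G, ?_, ?_⟩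
  · simp only [hG]
    exact b.linearIndependent.map' D.subtype D.ker_subtype
  · ext Q
    constructor
    · rintro ⟨hQ, hQD⟩
      refine ⟨b.repr ⟨_, hQD⟩, ?_⟩
      refine eq_of_mkQ_logE_eq hE
        (sNorm_mem_stochasticFamily hE hrow (expE_mem_positiveEdgeFun _)) hQ ?_
      refine sub_left_injective (b := (antiShift E).mkQ K) ?_
      change _ - _ = _ - _
      rw [hclass, b.sum_repr]
    · rintro ⟨θ, rfl⟩
      refine ⟨sNorm_mem_stochasticFamily hE hrow (expE_mem_positiveEdgeFun _), ?_⟩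
      rw [hclass]
      exact Subtype.property _

/-- If `V` is relatively closed in `W(Y, E)` and open in the set `H` of stochastic matrices with
logarithmic class in `a + D`, then it exhausts `H`, as `H` is a continuous image of `a + D`. -/
theorem eq_setOf_class_mem (hE : StronglyConnected E) (hrow : ∀ y, ∃ y', (y, y') ∈ E)
    {D : Submodule ℝ (EdgeFun E ⧸ antiShift E)} {a : EdgeFun E ⧸ antiShift E}
    {V Z : Set (EdgeFun E)} (hZ : IsClosed Z) (hVZ : V = stochasticFamily E ∩ Z)
    (hne : V.Nonempty)
    (hsub : V ⊆ {Q | Q ∈ stochasticFamily E ∧ (antiShift E).mkQ (logE Q) - a ∈ D})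
    (hopen : ∀ p ∈ V, V ∈ nhdsWithin p
      {Q | Q ∈ stochasticFamily E ∧ (antiShift E).mkQ (logE Q) - a ∈ D}) :
    V = {Q | Q ∈ stochasticFamily E ∧ (antiShift E).mkQ (logE Q) - a ∈ D} := by
  refine hsub.antisymm ?_
  let s : D → EdgeFun E := fun z => classSection (a + z)
  have hs : Continuous s :=
    (continuous_classSection hE hrow).comp (continuous_const.add continuous_subtype_val)
  have hsW : ∀ z, s z ∈ stochasticFamily E := fun z => classSection_mem hE hrow _
  have hsH : ∀ z, s z ∈ {Q | Q ∈ stochasticFamily E ∧ (antiShift E).mkQ (logE Q) - a ∈ D} := by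
    intro z
    refine ⟨hsW z, ?_⟩
    rw [mkQ_logE_classSection hE, add_sub_cancel_left]
    exact z.2
  have hsurj : ∀ Q, ∀ hQ : Q ∈ stochasticFamily E ∧ (antiShift E).mkQ (logE Q) - a ∈ D,
      s ⟨_, hQ.2⟩ = Q := by
    intro Q hQ
    refine eq_of_mkQ_logE_eq hE (hsW _) hQ.1 ?_
    rw [mkQ_logE_classSection hE, add_sub_cancel]
  have hclosed : IsClosed (s ⁻¹' V) := by
    have : s ⁻¹' V = s ⁻¹' Z := by
      ext z
      simp only [Set.mem_preimage, hVZ, Set.mem_inter_iff, hsW z, true_and]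
    rw [this]
    exact hZ.preimage hs
  have hop : IsOpen (s ⁻¹' V) := by
    rw [isOpen_iff_mem_nhds]
    intro z hz
    exact (tendsto_nhdsWithin_iff.mpr ⟨hs.continuousAt, Filter.Eventually.of_forall hsH⟩)
      (hopen _ hz)
  obtain ⟨P₀, hP₀⟩ := hne
  have hne' : (s ⁻¹' V).Nonempty := ⟨_, by rwa [Set.mem_preimage, hsurj P₀ (hsub hP₀)]⟩
  have huniv := IsClopen.eq_univ ⟨hclosed, hop⟩ hne'
  intro Q hQ
  rw [← hsurj Q hQ]
  exact huniv.symm.subset (Set.mem_univ (⟨_, hQ.2⟩ : D))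

end Hull

/-- For a submanifold, the infimum defining `manifoldDim` is attained. -/
theorem isSubmanifoldOfDim_manifoldDim {M : Type*} [NormedAddCommGroup M] [NormedSpace ℝ M]
    {S : Set M} (hS : IsSubmanifold S) : IsSubmanifoldOfDim (manifoldDim S) S :=
  Nat.sInf_mem (s := {d | IsSubmanifoldOfDim d S}) hS

end MarkovEFamily

theorem mainTheorem2 {Y : Type*} [Fintype Y] [DecidableEq Y] (E : Finset (Y × Y))
    (hE : MarkovEFamily.StronglyConnected E)
    (V : Set (MarkovEFamily.EdgeFun E)) (hne : V.Nonempty)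
    (hV : MarkovEFamily.IsSubmanifold V)
    (hdim : MarkovEFamily.manifoldDim V = MarkovEFamily.manifoldDim (MarkovEFamily.eHull V))
    {U : Type*} [AddCommGroup U] [Module ℝ U] [TopologicalSpace U] [IsTopologicalAddGroup U]
    [ContinuousSMul ℝ U] [T2Space U] [FiniteDimensional ℝ U]
    (φ : MarkovEFamily.EdgeFun E →ₗ[ℝ] U) (C : U)
    (hVL : V = MarkovEFamily.stochasticFamily E ∩ {F | φ F = C}) :
    MarkovEFamily.IsEFamily V := by
  have hVW : V ⊆ MarkovEFamily.stochasticFamily E := hVL ▸ Set.inter_subset_left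
  obtain ⟨P₀, hP₀⟩ := id hne
  have hrow := MarkovEFamily.exists_edge_of_mem_stochasticFamily (hVW hP₀)
  have hhull := MarkovEFamily.eHull_eq_setOf hE hVW hP₀
  have hsub : V ⊆ MarkovEFamily.eHull V := fun P hP => by
    rw [hhull]
    exact ⟨hVW hP, Submodule.subset_span ⟨P, hP, rfl⟩⟩
  have hVd := MarkovEFamily.isSubmanifoldOfDim_manifoldDim hV
  have hHd : MarkovEFamily.IsSubmanifoldOfDim (MarkovEFamily.manifoldDim V)
      (MarkovEFamily.eHull V) := by
    rw [hdim]
    -- The hull has some dimension, so `manifoldDim` is not the infimum of the empty set.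
    refine MarkovEFamily.isSubmanifoldOfDim_manifoldDim ?_
    rw [hhull]
    exact ⟨_, MarkovEFamily.isSubmanifoldOfDim_setOf_class_mem hE hrow _ _⟩
  have hopen : ∀ p ∈ V, V ∈ nhdsWithin p (MarkovEFamily.eHull V) := fun p hp =>
    hVd.mem_nhdsWithin hHd hsub hp
  rw [hhull] at hsub hopen
  have hclosed : IsClosed {F | φ F = C} :=
    isClosed_eq φ.continuous_of_finiteDimensional continuous_const
  rw [MarkovEFamily.eq_setOf_class_mem hE hrow hclosed hVL hne hsub hopen]
  exact MarkovEFamily.isEFamily_setOf_class_mem hE hrow _ _
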